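/- Let $k\ge 2$ be an integer, $a=2^k$, and \[ \gamma(a)=\frac{2a-1+\sqrt{4a^2+12a+1}}{2a}. \] Then the regular continued fraction of $\gamma(a)$ is \[ \gamma(a)=[\,2;\,\overline{a,\,1,\,2a+1,\,1,\,a,\;C_0,\,C_1,\,\ldots,\,C_{2k-3}}\,], \] where $C_j=2^{e_j}$ with $e_{2i}=i+1$ and $e_{2i+1}=k-1-i$ for $0\le i<k-1$; that is, $(e_0,e_1,e_2,e_3,\ldots)=(1,k-1,2,k-2,\ldots)$ interleaves the ascending ramp $(1,2,\ldots,k-1)$ with the descending ramp $(k-1,k-2,\ldots,1)$. The (minimal) period length of the continued fraction is $2k+3$. The tail $(C_0,\ldots,C_{2k-3})$ is a palindrome of $2(k-1)$ powers of two. Moreover the expansion is purely periodic after a cyclic shift of the repeating block: \[ \gamma(a)=[\,\overline{2,\,a,\,1,\,2a+1,\,1,\,a,\;C_0,\,\ldots,\,C_{2k-4}}\,]. \] -/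

import Mathlib

/-- The slope `γ(a) = (2a - 1 + √(4a² + 12a + 1)) / (2a)` of the double sieve. -/
noncomputable def doubleSieveSlope (a : ℕ) : ℝ :=
  (2 * (a : ℝ) - 1 + Real.sqrt (4 * (a : ℝ) ^ 2 + 12 * (a : ℝ) + 1)) / (2 * (a : ℝ))

/-- The sequence `pre, block, block, block, …` (for a nonempty `block`). -/
def eventuallyPeriodicSeq (pre block : List ℕ) (n : ℕ) : ℕ :=
  if n < pre.length then pre.getD n 0
  else block.getD ((n - pre.length) % block.length) 0

/-- The regular continued fraction expansion of the real number `x` (as produced by the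
continued fraction algorithm) is infinite, with partial quotients `c 0, c 1, c 2, …`. -/
def HasPartialQuotients (x : ℝ) (c : ℕ → ℕ) : Prop :=
  (GenContFract.of x).h = (c 0 : ℝ) ∧
    ∀ n : ℕ, (GenContFract.of x).s.get? n = some ⟨1, (c (n + 1) : ℝ)⟩

/-- The continued fraction of `x` consists of `pre` followed by `block` repeated for ever.
For `pre = [c₀]` this is `x = [c₀; block, block, …]`; for `pre = []` it is the purely periodic
expansion with repeating block `block`. -/
def HasPeriodicContFract (x : ℝ) (pre block : List ℕ) : Prop :=
  block ≠ [] ∧ HasPartialQuotients x (eventuallyPeriodicSeq pre block)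

/-- `p` is a (not necessarily minimal) period length of the continued fraction of `x`: from some
point on, the partial quotients repeat after `p` steps. -/
def IsContFractPeriod (x : ℝ) (p : ℕ) : Prop :=
  0 < p ∧ ∃ N : ℕ, ∀ n : ℕ, N ≤ n →
    (GenContFract.of x).partDens.get? (n + p) = (GenContFract.of x).partDens.get? n

/-- The head `a, 1, 2a + 1, 1, a` of the repeating block. -/
def cfHead (a : ℕ) : List ℕ := [a, 1, 2 * a + 1, 1, a]

/-- The exponents `1, k - 1, 2, k - 2, 3, k - 3, …` interleaving an ascending and a descending
ramp. -/
def tailExponent (k j : ℕ) : ℕ := if j % 2 = 0 then j / 2 + 1 else k - 1 - j / 2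

/-- The tail `C₀, …, C_{2k-3}` of the repeating block, with `C_j = 2 ^ e_j`. -/
def cfTail (k : ℕ) : List ℕ := (List.range (2 * (k - 1))).map fun j => 2 ^ tailExponent k j

/-- The repeating block, head followed by tail, for `a = 2 ^ k`. -/
def cfBlock (k : ℕ) : List ℕ := cfHead (2 ^ k) ++ cfTail k

/-! Put s = √(4a² + 12a + 1). Every complete quotient has numerator 2a + 1 + s or 2a - 1 + s, and
each step reduces to s² - (2a + 1)² = 8a or s² - (2a - 1)² = 16a. In the tail the denominators
change by powers of two until, because a = 2^k, the chain closes up (`slopeQuotient_cycle`). All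
quotients exceed 1, so the continued fraction algorithm must produce this chain. The slope is the
last quotient of the cycle, hence purely periodic. The period is minimal because 2a + 1 occurs only
once in the block. -/

/-- If `X n = c n + 1 / X (n + 1)` and `X (n + 1) > 1` for all `n`, the `X n` are the complete
quotients and the `c n` the partial quotients of `X 0`. -/
theorem hasPartialQuotients_of_completeQuotients (X : ℕ → ℝ) (c : ℕ → ℕ)
    (hX : ∀ n, X n = c n + (X (n + 1))⁻¹) (hgt : ∀ n, 1 < X (n + 1)) :
    HasPartialQuotients (X 0) c := by
  have hfloor (n : ℕ) : ⌊X n⌋ = (c n : ℤ) := by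
    have h1 := inv_lt_one_of_one_lt₀ (hgt n)
    have h0 : 0 < (X (n + 1))⁻¹ := inv_pos.2 (zero_lt_one.trans (hgt n))
    rw [Int.floor_eq_iff, hX n]
    push_cast
    constructor <;> linarith
  have hfract (n : ℕ) : Int.fract (X n) = (X (n + 1))⁻¹ := by
    rw [Int.fract, hfloor n]
    have := hX n
    push_cast
    linarith
  have hstream (n : ℕ) :
      GenContFract.IntFractPair.stream (X 0) n = some ⟨(c n : ℤ), (X (n + 1))⁻¹⟩ := by
    induction n with
    | zero =>
      rw [GenContFract.IntFractPair.stream_zero, GenContFract.IntFractPair.of, hfloor, hfract]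
    | succ n ih =>
      rw [GenContFract.IntFractPair.stream_succ_of_some ih
        (inv_ne_zero (zero_lt_one.trans (hgt n)).ne')]
      simp only [inv_inv, GenContFract.IntFractPair.of, hfloor, hfract]
  refine ⟨?_, fun n => ?_⟩
  · rw [GenContFract.of_h_eq_floor, hfloor]
    simp
  · rw [GenContFract.get?_of_eq_some_of_succ_get?_intFractPair_stream (hstream (n + 1))]
    simp

/-- A cyclic chain of complete quotients gives periodic partial quotients. -/
theorem hasPartialQuotients_of_cycle {L : ℕ} (hL : 0 < L) (Z : ℕ → ℝ) (b : ℕ → ℕ)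
    (hZ : ∀ j < L, Z j = b j + (Z (j + 1))⁻¹) (hgt : ∀ j < L, 1 < Z j) (hcycle : Z L = Z 0)
    (m : ℕ) :
    HasPartialQuotients (Z (m % L)) (fun n => b ((n + m) % L)) := by
  have h := hasPartialQuotients_of_completeQuotients (fun n => Z ((n + m) % L))
    (fun n => b ((n + m) % L)) (fun n => ?_) (fun n => hgt _ (Nat.mod_lt _ hL))
  · simpa using h
  · have hlt := Nat.mod_lt (n + m) hL
    have hnext : Z ((n + 1 + m) % L) = Z ((n + m) % L + 1) := by
      rw [add_right_comm, ← Nat.mod_add_mod]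
      rcases Nat.lt_or_ge ((n + m) % L + 1) L with h | h
      · rw [Nat.mod_eq_of_lt h]
      · rw [show (n + m) % L + 1 = L by omega, Nat.mod_self, hcycle]
    simp only [hnext]
    exact hZ _ hlt

theorem cfTail_length (k : ℕ) : (cfTail k).length = 2 * (k - 1) := by simp [cfTail]

theorem cfBlock_length {k : ℕ} (hk : 2 ≤ k) : (cfBlock k).length = 2 * k + 3 := by
  simp [cfBlock, cfHead, cfTail_length]
  omega

theorem cfTail_getElem? {k j : ℕ} (hj : j < 2 * (k - 1)) :
    (cfTail k)[j]? = some (2 ^ tailExponent k j) := by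
  simp [cfTail, hj]

theorem cfBlock_getD_add_five {k j : ℕ} (hj : j < 2 * (k - 1)) :
    (cfBlock k).getD (j + 5) 0 = 2 ^ tailExponent k j := by
  simp [cfBlock, cfHead, cfTail_getElem? hj]

theorem tailExponent_even (k i : ℕ) : tailExponent k (2 * i) = i + 1 := by
  simp [tailExponent]

theorem tailExponent_odd (k i : ℕ) : tailExponent k (2 * i + 1) = k - 1 - i := by
  have h : (2 * i + 1) / 2 = i := by omega
  simp [tailExponent, h]

theorem cfTail_palindrome (k : ℕ) : (cfTail k).Palindrome := by
  refine List.Palindrome.of_reverse_eq (List.ext_getElem (by simp) fun j h₁ h₂ => ?_)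
  rw [cfTail_length] at h₂
  rw [List.getElem_reverse]
  simp only [cfTail, List.getElem_map, List.getElem_range, List.length_map, List.length_range]
  congr 1
  rcases Nat.even_or_odd' j with ⟨i, rfl | rfl⟩
  -- Reflection in a list of even length swaps parities, so it exchanges the two ramps.
  · rw [show 2 * (k - 1) - 1 - 2 * i = 2 * (k - 2 - i) + 1 by omega, tailExponent_even,
      tailExponent_odd]
    omega
  · rw [show 2 * (k - 1) - 1 - (2 * i + 1) = 2 * (k - 2 - i) by omega, tailExponent_even,
      tailExponent_odd]
    omega

/-- The complete quotients of the slope, as functions of `a` and `s = √(4a² + 12a + 1)`. -/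
noncomputable def slopeQuotient (a s : ℝ) : ℕ → ℝ
  | 0 => (2 * a + 1 + s) / 4
  | 1 => (2 * a - 1 + s) / (4 * a)
  | 2 => (2 * a + 1 + s) / 2
  | 3 => (2 * a + 1 + s) / (4 * a)
  | 4 => (2 * a - 1 + s) / 4
  | j + 5 => if j % 2 = 0 then (2 * a + 1 + s) * 2 ^ (j / 2) / (2 * a)
      else (2 * a - 1 + s) / (8 * 2 ^ (j / 2))

theorem slopeQuotient_even (a s : ℝ) (i : ℕ) :
    slopeQuotient a s (2 * i + 5) = (2 * a + 1 + s) * 2 ^ i / (2 * a) := by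
  simp [slopeQuotient]

theorem slopeQuotient_odd (a s : ℝ) (i : ℕ) :
    slopeQuotient a s (2 * i + 6) = (2 * a - 1 + s) / (8 * 2 ^ i) := by
  have h : (2 * i + 1) / 2 = i := by omega
  simp [slopeQuotient, h]

theorem eq_add_inv_of_sub_mul_eq_one {x y c : ℝ} (h : (x - c) * y = 1) : x = c + y⁻¹ := by
  have := eq_inv_of_mul_eq_one_left h
  linarith

theorem slopeQuotient_step {k : ℕ} {a s : ℝ} (ha : a = 2 ^ k)
    (hs : s ^ 2 = 4 * a ^ 2 + 12 * a + 1) {j : ℕ} (hj : j < 2 * k + 3) :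
    slopeQuotient a s j = ((cfBlock k).getD j 0 : ℕ) + (slopeQuotient a s (j + 1))⁻¹ := by
  have ha0 : a ≠ 0 := by rw [ha]; positivity
  apply eq_add_inv_of_sub_mul_eq_one
  match j with
  | 0 =>
    simp only [slopeQuotient, cfBlock, cfHead, List.cons_append, List.getD_cons_zero]
    push_cast
    rw [← ha]
    field_simp
    linear_combination hs
  | 1 =>
    simp only [slopeQuotient, cfBlock, cfHead, List.cons_append, List.getD_cons_zero,
      List.getD_cons_succ]
    push_cast
    field_simp
    linear_combination hs
  | 2 =>
    simp only [slopeQuotient, cfBlock, cfHead, List.cons_append, List.getD_cons_zero,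
      List.getD_cons_succ]
    push_cast
    rw [← ha]
    field_simp
    linear_combination hs
  | 3 =>
    simp only [slopeQuotient, cfBlock, cfHead, List.cons_append, List.getD_cons_zero,
      List.getD_cons_succ]
    push_cast
    field_simp
    linear_combination hs
  | 4 =>
    rw [slopeQuotient_even a s 0]
    simp only [slopeQuotient, cfBlock, cfHead, List.cons_append, List.getD_cons_zero,
      List.getD_cons_succ]
    push_cast
    rw [← ha]
    field_simp
    linear_combination hs
  | j + 5 =>
    rw [cfBlock_getD_add_five (by omega)]
    rcases Nat.even_or_odd' j with ⟨i, rfl | rfl⟩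
    · rw [slopeQuotient_even, slopeQuotient_odd, tailExponent_even]
      push_cast
      have h2 : (2 : ℝ) ^ i ≠ 0 := by positivity
      rw [pow_succ]
      field_simp
      linear_combination hs
    · rw [show 2 * i + 1 + 5 = 2 * i + 6 by ring, slopeQuotient_odd,
        show 2 * i + 6 + 1 = 2 * (i + 1) + 5 by ring, slopeQuotient_even, tailExponent_odd]
      push_cast
      have h2 : (2 : ℝ) ^ i ≠ 0 := by positivity
      -- The only step of the chain that needs a to be a power of two.
      have hak : a = 2 * 2 ^ i * 2 ^ (k - 1 - i) := by
        rw [ha, ← pow_succ', ← pow_add]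
        congr 1
        omega
      have hv : (2 : ℝ) ^ (k - 1 - i) = a / (2 * 2 ^ i) := by
        rw [hak]; field_simp
      rw [hv, pow_succ]
      field_simp
      linear_combination 2 * hs

theorem one_lt_slopeQuotient {k : ℕ} {a s : ℝ} (ha : a = 2 ^ k) (hs : 2 * a + 1 < s) {j : ℕ}
    (hj : j < 2 * k + 3) : 1 < slopeQuotient a s j := by
  have ha1 : 1 ≤ a := by rw [ha]; exact one_le_pow₀ one_le_two
  match j with
  | 0 => simp only [slopeQuotient]; rw [lt_div_iff₀ (by positivity)]; linarith
  | 1 => simp only [slopeQuotient]; rw [lt_div_iff₀ (by positivity)]; linarith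
  | 2 => simp only [slopeQuotient]; rw [lt_div_iff₀ (by positivity)]; linarith
  | 3 => simp only [slopeQuotient]; rw [lt_div_iff₀ (by positivity)]; linarith
  | 4 => simp only [slopeQuotient]; rw [lt_div_iff₀ (by positivity)]; linarith
  | j + 5 =>
    rcases Nat.even_or_odd' j with ⟨i, rfl | rfl⟩
    · rw [slopeQuotient_even, lt_div_iff₀ (by positivity)]
      have h1 : (1 : ℝ) ≤ 2 ^ i := one_le_pow₀ one_le_two
      nlinarith
    · rw [show 2 * i + 1 + 5 = 2 * i + 6 by ring, slopeQuotient_odd, lt_div_iff₀ (by positivity)]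
      -- Here i ≤ k - 2, so the denominator 8 * 2^i is at most 2a, while the numerator exceeds 4a.
      have h1 : (4 : ℝ) * 2 ^ i ≤ a := by
        rw [ha, show (4 : ℝ) = 2 ^ 2 by norm_num, ← pow_add]
        exact pow_le_pow_right₀ one_le_two (by omega)
      linarith

theorem slopeQuotient_cycle {k : ℕ} (hk : 2 ≤ k) {a s : ℝ} (ha : a = 2 ^ k) :
    slopeQuotient a s (2 * k + 3) = slopeQuotient a s 0 := by
  obtain ⟨i, rfl⟩ := Nat.exists_eq_add_of_le' hk
  have h2 : (2 : ℝ) ^ i ≠ 0 := by positivity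
  rw [show 2 * (i + 2) + 3 = 2 * (i + 1) + 5 by ring, slopeQuotient_even, slopeQuotient]
  have ha' : a = 4 * 2 ^ i := by rw [ha, pow_add]; ring
  rw [ha', pow_succ]
  field_simp

/-- At i = k - 2 the denominator 8 * 2^i equals 2a. -/
theorem doubleSieveSlope_eq_slopeQuotient {k : ℕ} (hk : 2 ≤ k) :
    doubleSieveSlope (2 ^ k) =
      slopeQuotient (2 ^ k) (√(4 * (2 ^ k) ^ 2 + 12 * 2 ^ k + 1)) (2 * k + 2) := by
  obtain ⟨i, rfl⟩ := Nat.exists_eq_add_of_le' hk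
  rw [show 2 * (i + 2) + 2 = 2 * i + 6 by ring, slopeQuotient_odd, doubleSieveSlope]
  push_cast
  congr 1
  rw [pow_add]
  ring

theorem doubleSieveSlope_hasPartialQuotients {k : ℕ} (hk : 2 ≤ k) :
    HasPartialQuotients (doubleSieveSlope (2 ^ k))
      (fun n => (cfBlock k).getD ((n + (2 * k + 2)) % (2 * k + 3)) 0) := by
  have hs : √(4 * ((2 : ℝ) ^ k) ^ 2 + 12 * 2 ^ k + 1) ^ 2 = 4 * (2 ^ k) ^ 2 + 12 * 2 ^ k + 1 :=
    Real.sq_sqrt (by positivity)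
  have hlt : 2 * (2 : ℝ) ^ k + 1 < √(4 * (2 ^ k) ^ 2 + 12 * 2 ^ k + 1) := by
    apply Real.lt_sqrt_of_sq_lt
    have : (0 : ℝ) < 2 ^ k := by positivity
    nlinarith
  have h := hasPartialQuotients_of_cycle (L := 2 * k + 3) (by omega)
    (slopeQuotient (2 ^ k) (√(4 * (2 ^ k) ^ 2 + 12 * 2 ^ k + 1)))
    (fun j => (cfBlock k).getD j 0) (fun j hj => slopeQuotient_step rfl hs hj)
    (fun j hj => one_lt_slopeQuotient rfl hlt hj) (slopeQuotient_cycle hk rfl) (2 * k + 2)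
  rwa [Nat.mod_eq_of_lt (by omega), ← doubleSieveSlope_eq_slopeQuotient hk] at h

theorem cfBlock_getD_last {k : ℕ} (hk : 2 ≤ k) : (cfBlock k).getD (2 * k + 2) 0 = 2 := by
  obtain ⟨i, rfl⟩ := Nat.exists_eq_add_of_le' hk
  rw [show 2 * (i + 2) + 2 = (2 * i + 1) + 5 by ring, cfBlock_getD_add_five (by omega),
    tailExponent_odd, show i + 2 - 1 - i = 1 by omega, pow_one]

theorem eventuallyPeriodicSeq_singleton_cfBlock {k : ℕ} (hk : 2 ≤ k) :
    eventuallyPeriodicSeq [2] (cfBlock k) =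
      fun n => (cfBlock k).getD ((n + (2 * k + 2)) % (2 * k + 3)) 0 := by
  funext n
  rcases n with _ | n
  · rw [zero_add, Nat.mod_eq_of_lt (by omega), cfBlock_getD_last hk]
    simp [eventuallyPeriodicSeq]
  · rw [show n + 1 + (2 * k + 2) = n + (2 * k + 3) by ring, Nat.add_mod_right]
    simp [eventuallyPeriodicSeq, cfBlock_length hk]

theorem eventuallyPeriodicSeq_nil_rotate (block : List ℕ) (hb : block ≠ []) (m : ℕ) :
    eventuallyPeriodicSeq [] (block.rotate m) =
      fun n => block.getD ((n + m) % block.length) 0 := by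
  funext n
  have hlen := Nat.mod_lt n (List.length_pos_iff.2 hb)
  simp [eventuallyPeriodicSeq, List.getElem?_rotate hlen]

/-- All other entries are 1 or powers of two, whereas 2a + 1 is odd and greater than 1. -/
theorem cfBlock_getD_eq_max {k j : ℕ} (hj : j < 2 * k + 3)
    (h : (cfBlock k).getD j 0 = 2 * 2 ^ k + 1) : j = 2 := by
  have hpos : 0 < 2 ^ k := by positivity
  match j with
  | 0 => simp [cfBlock, cfHead] at h; omega
  | 1 => simp [cfBlock, cfHead] at h
  | 2 => rfl
  | 3 => simp [cfBlock, cfHead] at h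
  | 4 => simp [cfBlock, cfHead] at h; omega
  | j + 5 =>
    rw [cfBlock_getD_add_five (by omega)] at h
    rcases Nat.eq_zero_or_pos (tailExponent k j) with h0 | h0
    · rw [h0] at h; omega
    · have : 2 ∣ 2 ^ tailExponent k j := dvd_pow_self 2 h0.ne'
      omega

/-- Partial denominators omit the integer part 2, so they start exactly at the head of the block. -/
theorem doubleSieveSlope_partDens {k : ℕ} (hk : 2 ≤ k) (n : ℕ) :
    (GenContFract.of (doubleSieveSlope (2 ^ k))).partDens.get? n =
      some (((cfBlock k).getD (n % (2 * k + 3)) 0 : ℕ) : ℝ) := by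
  rw [GenContFract.partDen_eq_s_b ((doubleSieveSlope_hasPartialQuotients hk).2 n)]
  dsimp only
  rw [show n + 1 + (2 * k + 2) = n + (2 * k + 3) by ring, Nat.add_mod_right]

theorem isLeast_isContFractPeriod_doubleSieveSlope {k : ℕ} (hk : 2 ≤ k) :
    IsLeast {p : ℕ | IsContFractPeriod (doubleSieveSlope (2 ^ k)) p} (2 * k + 3) := by
  refine ⟨⟨by omega, 0, fun n _ => ?_⟩, fun p ⟨hp, N, hN⟩ => ?_⟩
  · rw [doubleSieveSlope_partDens hk, doubleSieveSlope_partDens hk, Nat.add_mod_right]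
  -- An index beyond N where the entry is 2a + 1; a shorter period would move it to another position
  -- in the block.
  · have h := hN (2 + (2 * k + 3) * N) (by nlinarith)
    rw [doubleSieveSlope_partDens hk, doubleSieveSlope_partDens hk, Option.some_inj, Nat.cast_inj,
      Nat.add_mul_mod_self_left, Nat.mod_eq_of_lt (show 2 < 2 * k + 3 by omega),
      add_right_comm, Nat.add_mul_mod_self_left] at h
    have h2 := cfBlock_getD_eq_max (Nat.mod_lt _ (by omega))
      (h.trans (by simp [cfBlock, cfHead]))
    by_contra! hlt
    rcases Nat.lt_or_ge (2 + p) (2 * k + 3) with h3 | h3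
    · rw [Nat.mod_eq_of_lt h3] at h2
      omega
    · rw [Nat.mod_eq_sub_mod h3, Nat.mod_eq_of_lt (by omega)] at h2
      omega

theorem proposition5 (k : ℕ) (hk : 2 ≤ k) :
    -- the expansion `γ(2^k) = [2; block, block, …]`
    HasPeriodicContFract (doubleSieveSlope (2 ^ k)) [2] (cfBlock k) ∧
    -- the block has `2k + 3` terms, and this is the exact period length
    (cfBlock k).length = 2 * k + 3 ∧
    IsLeast {p : ℕ | IsContFractPeriod (doubleSieveSlope (2 ^ k)) p} (2 * k + 3) ∧
    -- a cyclic shift of the block gives a purely periodic expansion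
    HasPeriodicContFract (doubleSieveSlope (2 ^ k)) [] ((cfBlock k).rotate (2 * k + 2)) ∧
    -- the tail is a palindrome of `2(k - 1)` powers of two, with the stated exponents
    (cfTail k).length = 2 * (k - 1) ∧
    (cfTail k).Palindrome ∧
    (∀ i : ℕ, i < k - 1 →
      (cfTail k)[2 * i]? = some (2 ^ (i + 1)) ∧
      (cfTail k)[2 * i + 1]? = some (2 ^ (k - 1 - i))) := by
  have hne : cfBlock k ≠ [] := by simp [cfBlock, cfHead]
  refine ⟨⟨hne, ?_⟩, cfBlock_length hk, isLeast_isContFractPeriod_doubleSieveSlope hk,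
    ⟨by simpa using hne, ?_⟩, cfTail_length k, cfTail_palindrome k, fun i hi => ⟨?_, ?_⟩⟩
  · rw [eventuallyPeriodicSeq_singleton_cfBlock hk]
    exact doubleSieveSlope_hasPartialQuotients hk
  · rw [eventuallyPeriodicSeq_nil_rotate _ hne, cfBlock_length hk]
    exact doubleSieveSlope_hasPartialQuotients hk
  · rw [cfTail_getElem? (by omega), tailExponent_even]
  · rw [cfTail_getElem? (by omega), tailExponent_odd]
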